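/- Let $0<\varepsilon<2$ and, for $x\in(0,1)$, put $$p(x)=(1-x)^{1+1/\varepsilon}(1+x)^{1-1/\varepsilon},\qquad w(x)=x^{-1}(1-x)^{1/\varepsilon}(1+x)^{-1/\varepsilon}.$$ On the complex Hilbert space $L^2((0,1),w(x)\,dx)$ let $L$ be the operator $$Lf=-w^{-1}(pf')',\qquad \operatorname{Dom}(L)=\{f\in C^\infty([0,1]) : f(0)=0\}.$$ Let $\gamma(x)=\int_0^x p(t)^{-1}\,dt$ for $x\in[0,1)$, and $G(x,y)=\gamma(\min(x,y))$ for $x,y\in[0,1]$ not both equal to $1$. Then $L$ is closable, and its closure $\bar L$ has a compact inverse $R$, given by the Hilbert–Schmidt kernel $G$. That is, $G\in L^2\big((0,1)\times(0,1),\,w(x)dx\times w(y)dy\big)$, and there is a compact operator $R$ on $L^2((0,1),w(x)\,dx)$ such that 1. for every $f\in L^2((0,1),w(x)\,dx)$ the integral $\int_0^1 G(x,y)f(y)w(y)\,dy$ converges absolutely for every $x\in[0,1)$, and the function of $x$ it defines represents $Rf$: $$(Rf)(x)=\int_0^1 G(x,y)f(y)w(y)\,dy ;$$ 2. $Rf\in\operatorname{Dom}(\bar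 L)$ and $\bar L Rf=f$ for every $f\in L^2((0,1),w(x)\,dx)$; 3. $R\bar L u=u$ for every $u\in\operatorname{Dom}(\bar L)$. -/

import Mathlib

open scoped ContDiff

namespace SturmLiouville

/-- `p(x) = (1-x)^{1+1/ε} (1+x)^{1-1/ε}` (used on `[0,1]`, where both bases are non-negative). -/
noncomputable def p (ε x : ℝ) : ℝ :=
  (1 - x) ^ (1 + 1 / ε) * (x + 1) ^ (1 - 1 / ε)

/-- `w(x) = x⁻¹ (1-x)^{1/ε} (1+x)^{-1/ε}` (used on `(0,1)`). -/
noncomputable def w (ε x : ℝ) : ℝ :=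
  x⁻¹ * (1 - x) ^ (1 / ε) * (x + 1) ^ (-(1 / ε))

/-- The measure `w(x) dx` on `(0,1)`. -/
noncomputable def wMeasure (ε : ℝ) : MeasureTheory.Measure ℝ :=
  (MeasureTheory.volume.restrict (Set.Ioo (0 : ℝ) 1)).withDensity
    (fun x => ENNReal.ofReal (w ε x))

/-- The complex Hilbert space `L²((0,1), w dx)`. -/
abbrev L2w (ε : ℝ) : Type := MeasureTheory.Lp ℂ 2 (wMeasure ε)

/-- `γ(x) = ∫₀ˣ p(t)⁻¹ dt`, for `x ∈ [0,1)` (at `x = 1` the integral diverges). -/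
noncomputable def γ (ε x : ℝ) : ℝ := ∫ t in (0 : ℝ)..x, (p ε t)⁻¹

/-- The kernel `G(x,y) = γ(min(x,y))`, for `x, y ∈ [0,1]` not both equal to `1`. -/
noncomputable def G (ε x y : ℝ) : ℝ := γ ε (min x y)

/-- The functions which are `C^∞` on the closed interval `[0,1]` and vanish at `0`.
(Functions are total on `ℝ`; their values outside `[0,1]` play no role.) -/
def smoothZero : Submodule ℂ (ℝ → ℂ) where
  carrier := {f | ContDiffOn ℝ ∞ f (Set.Icc 0 1) ∧ f 0 = 0}
  zero_mem' := ⟨contDiffOn_const, rfl⟩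
  add_mem' := fun hf hg => ⟨hf.1.add hg.1, by simp [hf.2, hg.2]⟩
  smul_mem' := fun c _ hf => ⟨hf.1.const_smul c, by simp [hf.2]⟩

/-- The differential expression `-w⁻¹ (p f')'`, used at points of `(0,1)`. -/
noncomputable def slExpr (ε : ℝ) (f : ℝ → ℂ) (x : ℝ) : ℂ :=
  -((w ε x)⁻¹ : ℂ) * deriv (fun t => (p ε t : ℂ) * deriv f t) x

theorem w_pos (ε : ℝ) {x : ℝ} (hx : x ∈ Set.Ioo (0 : ℝ) 1) : 0 < w ε x := by
  have h1 : 0 < 1 - x := by linarith [hx.2]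
  have h2 : 0 < x + 1 := by linarith [hx.1]
  have h3 := hx.1
  unfold w
  positivity

theorem w_le (ε : ℝ) (hε : 0 < ε) {x : ℝ} (hx : x ∈ Set.Ioo (0 : ℝ) 1) : w ε x ≤ x⁻¹ := by
  have h1 : 0 < 1 - x := by linarith [hx.2]
  have h2 : 0 < x + 1 := by linarith [hx.1]
  have h3 := hx.1
  have hε' : 0 ≤ 1 / ε := by positivity
  have a : (1 - x) ^ (1 / ε) ≤ 1 := Real.rpow_le_one h1.le (by linarith) hε'
  have b : (x + 1) ^ (-(1 / ε)) ≤ 1 :=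
    Real.rpow_le_one_of_one_le_of_nonpos (by linarith) (by linarith)
  have a0 : 0 ≤ (1 - x) ^ (1 / ε) := by positivity
  have b0 : 0 ≤ (x + 1) ^ (-(1 / ε)) := by positivity
  have hi : 0 < x⁻¹ := by positivity
  unfold w
  calc x⁻¹ * (1 - x) ^ (1 / ε) * (x + 1) ^ (-(1 / ε)) ≤ x⁻¹ * 1 * 1 := by gcongr
    _ = x⁻¹ := by ring

theorem measurable_w (ε : ℝ) : Measurable (w ε) := by
  unfold w
  fun_prop

theorem ae_wMeasure_iff (ε : ℝ) {P : ℝ → Prop} :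
    (∀ᵐ x ∂(wMeasure ε), P x) ↔
      ∀ᵐ x ∂(MeasureTheory.volume.restrict (Set.Ioo (0 : ℝ) 1)), P x := by
  unfold wMeasure
  rw [MeasureTheory.ae_withDensity_iff (measurable_w ε).ennreal_ofReal]
  have h : ∀ᵐ x ∂(MeasureTheory.volume.restrict (Set.Ioo (0 : ℝ) 1)), x ∈ Set.Ioo (0 : ℝ) 1 :=
    MeasureTheory.ae_restrict_mem measurableSet_Ioo
  constructor
  · intro H
    filter_upwards [H, h] with x hx hx'
    exact hx (by simpa using w_pos ε hx')
  · intro H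
    filter_upwards [H] with x hx _ using hx

/-- A function continuous on `(0,1)` that is `O(x)` belongs to `L²((0,1), w dx)`. -/
theorem memLp_of_bound (ε : ℝ) (hε : 0 < ε) {g : ℝ → ℂ} (hg : ContinuousOn g (Set.Ioo 0 1))
    {C : ℝ} (hC : ∀ x ∈ Set.Ioo (0 : ℝ) 1, ‖g x‖ ≤ C * x) :
    MeasureTheory.MemLp g 2 (wMeasure ε) := by
  have hm : MeasureTheory.AEStronglyMeasurable g
      (MeasureTheory.volume.restrict (Set.Ioo (0 : ℝ) 1)) :=
    hg.aestronglyMeasurable measurableSet_Ioo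
  have hm' : MeasureTheory.AEStronglyMeasurable g (wMeasure ε) :=
    hm.mono_ac (MeasureTheory.withDensity_absolutelyContinuous _ _)
  rw [MeasureTheory.memLp_two_iff_integrable_sq_norm hm']
  unfold wMeasure
  rw [MeasureTheory.integrable_withDensity_iff_integrable_smul'
    (measurable_w ε).ennreal_ofReal (by simp)]
  have hf : MeasureTheory.IsFiniteMeasure
      (MeasureTheory.volume.restrict (Set.Ioo (0 : ℝ) 1)) := ⟨by simp⟩
  refine MeasureTheory.Integrable.of_bound (C := C ^ 2) ?_ ?_
  · exact ((measurable_w ε).ennreal_ofReal.ennreal_toReal.aestronglyMeasurable).smul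
      (hm.norm.pow 2)
  · filter_upwards [MeasureTheory.ae_restrict_mem measurableSet_Ioo] with x hx
    have hw := w_pos ε hx
    have hx0 := hx.1
    rw [ENNReal.toReal_ofReal hw.le, smul_eq_mul, Real.norm_eq_abs,
      abs_of_nonneg (by positivity)]
    have h0 := norm_nonneg (g x)
    calc w ε x * ‖g x‖ ^ 2 ≤ x⁻¹ * (C * x) ^ 2 := by
          gcongr
          · exact w_le ε hε hx
          · exact hC x hx
      _ = C ^ 2 * x := by field_simp
      _ ≤ C ^ 2 := by nlinarith [sq_nonneg C, hx.2]

theorem memLp_smoothZero (ε : ℝ) (hε : 0 < ε) (f : smoothZero) :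
    MeasureTheory.MemLp (f : ℝ → ℂ) 2 (wMeasure ε) := by
  obtain ⟨f, hf, hf0⟩ := f
  have hu : UniqueDiffOn ℝ (Set.Icc (0 : ℝ) 1) := uniqueDiffOn_Icc zero_lt_one
  have hd : ContinuousOn (derivWithin f (Set.Icc 0 1)) (Set.Icc 0 1) :=
    hf.continuousOn_derivWithin hu (by simp)
  obtain ⟨C, hC⟩ := isCompact_Icc.exists_bound_of_continuousOn hd
  refine memLp_of_bound ε hε (C := C) (hf.continuousOn.mono Set.Ioo_subset_Icc_self) ?_
  intro x hx
  have := (convex_Icc (0 : ℝ) 1).norm_image_sub_le_of_norm_derivWithin_le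
    (hf.differentiableOn (by simp)) hC (Set.left_mem_Icc.2 zero_le_one)
    (Set.Ioo_subset_Icc_self hx)
  simpa [hf0, abs_of_pos hx.1] using this

theorem hasDerivAt_p (ε : ℝ) {x : ℝ} (hx : x ∈ Set.Ioo (0 : ℝ) 1) :
    HasDerivAt (p ε)
      (-2 * (x + 1 / ε) * ((1 - x) ^ (1 / ε) * (x + 1) ^ (-(1 / ε)))) x := by
  have h1 : 0 < 1 - x := by linarith [hx.2]
  have h2 : 0 < x + 1 := by linarith [hx.1]
  have a := ((hasDerivAt_id x).const_sub 1).rpow_const (p := 1 + 1 / ε) (Or.inl h1.ne')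
  have b := ((hasDerivAt_id x).add_const 1).rpow_const (p := 1 - 1 / ε) (Or.inl h2.ne')
  refine (a.mul b).congr_deriv ?_
  simp only [id]
  have e1 : (1 - x) ^ (1 + 1 / ε) = (1 - x) * (1 - x) ^ (1 / ε) := by
    rw [Real.rpow_add h1, Real.rpow_one]
  have e2 : (x + 1) ^ (1 - 1 / ε) = (x + 1) * (x + 1) ^ (-(1 / ε)) := by
    rw [sub_eq_add_neg, Real.rpow_add h2, Real.rpow_one]
  have e3 : 1 + 1 / ε - 1 = 1 / ε := by ring
  have e4 : 1 - 1 / ε - 1 = -(1 / ε) := by ring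
  rw [e3, e4, e1, e2]
  ring

theorem differentiableAt_deriv (f : smoothZero) {x : ℝ} (hx : x ∈ Set.Ioo (0 : ℝ) 1) :
    DifferentiableAt ℝ (f : ℝ → ℂ) x ∧ DifferentiableAt ℝ (deriv (f : ℝ → ℂ)) x := by
  obtain ⟨f, hf, hf0⟩ := f
  have h : ContDiffOn ℝ ∞ f (Set.Ioo 0 1) := hf.mono Set.Ioo_subset_Icc_self
  have h' : ContDiffOn ℝ ∞ (deriv f) (Set.Ioo 0 1) := h.deriv_of_isOpen isOpen_Ioo (by simp)
  have hn : Set.Ioo (0 : ℝ) 1 ∈ nhds x := isOpen_Ioo.mem_nhds hx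
  exact ⟨(h.differentiableOn (by simp)).differentiableAt hn,
    (h'.differentiableOn (by simp)).differentiableAt hn⟩

/-- On `(0,1)`, `-w⁻¹ (p f')' = -x ((1 - x²) f'' - 2 (x + 1/ε) f')`. -/
theorem slExpr_eq (ε : ℝ) (f : smoothZero) {x : ℝ} (hx : x ∈ Set.Ioo (0 : ℝ) 1) :
    slExpr ε f x = -(x : ℂ) * ((1 - (x : ℂ) ^ 2) * deriv (deriv (f : ℝ → ℂ)) x
      - 2 * (x + 1 / ε) * deriv (f : ℝ → ℂ) x) := by
  have h1 : 0 < 1 - x := by linarith [hx.2]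
  have h2 : 0 < x + 1 := by linarith [hx.1]
  have h := (hasDerivAt_p ε hx).ofReal_comp.mul (differentiableAt_deriv f hx).2.hasDerivAt
  have h' : deriv (fun t => (p ε t : ℂ) * deriv (f : ℝ → ℂ) t) x = _ := h.deriv
  unfold slExpr
  rw [h']
  have e1 : (1 - x) ^ (1 + 1 / ε) = (1 - x) * (1 - x) ^ (1 / ε) := by
    rw [Real.rpow_add h1, Real.rpow_one]
  have e2 : (x + 1) ^ (1 - 1 / ε) = (x + 1) * (x + 1) ^ (-(1 / ε)) := by
    rw [sub_eq_add_neg, Real.rpow_add h2, Real.rpow_one]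
  have hA : ((1 - x) ^ (1 / ε) : ℝ) ≠ 0 := (Real.rpow_pos_of_pos h1 _).ne'
  have hB : ((x + 1) ^ (-(1 / ε)) : ℝ) ≠ 0 := (Real.rpow_pos_of_pos h2 _).ne'
  unfold p w
  rw [e1, e2]
  generalize (1 - x) ^ (1 / ε) = A at *
  generalize (x + 1) ^ (-(1 / ε)) = B at *
  have hA' : (A : ℂ) ≠ 0 := by exact_mod_cast hA
  have hB' : (B : ℂ) ≠ 0 := by exact_mod_cast hB
  have hx' : (x : ℂ) ≠ 0 := by exact_mod_cast hx.1.ne'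
  push_cast
  generalize (1 / (ε : ℂ)) = c
  field_simp
  ring

theorem memLp_slExpr (ε : ℝ) (hε : 0 < ε) (f : smoothZero) :
    MeasureTheory.MemLp (slExpr ε f) 2 (wMeasure ε) := by
  have hu : UniqueDiffOn ℝ (Set.Icc (0 : ℝ) 1) := uniqueDiffOn_Icc zero_lt_one
  have hd1 : ContDiffOn ℝ ∞ (derivWithin (f : ℝ → ℂ) (Set.Icc 0 1)) (Set.Icc 0 1) :=
    f.2.1.derivWithin hu (by simp)
  have hd2 : ContinuousOn (derivWithin (derivWithin (f : ℝ → ℂ) (Set.Icc 0 1)) (Set.Icc 0 1))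
      (Set.Icc 0 1) := hd1.continuousOn_derivWithin hu (by simp)
  have hd1' := hd1.continuousOn
  have E1 : Set.EqOn (deriv (f : ℝ → ℂ)) (derivWithin (f : ℝ → ℂ) (Set.Icc 0 1))
      (Set.Ioo 0 1) := fun x hx => (derivWithin_of_mem_nhds (Icc_mem_nhds hx.1 hx.2)).symm
  have E2 : ∀ x ∈ Set.Ioo (0 : ℝ) 1, deriv (deriv (f : ℝ → ℂ)) x =
      derivWithin (derivWithin (f : ℝ → ℂ) (Set.Icc 0 1)) (Set.Icc 0 1) x := by
    intro x hx
    rw [derivWithin_of_mem_nhds (Icc_mem_nhds hx.1 hx.2)]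
    exact (E1.eventuallyEq_of_mem (isOpen_Ioo.mem_nhds hx)).deriv_eq
  set d1 := derivWithin (f : ℝ → ℂ) (Set.Icc 0 1)
  set d2 := derivWithin d1 (Set.Icc 0 1)
  have hH : ContinuousOn (fun x : ℝ => (1 - (x : ℂ) ^ 2) * d2 x - 2 * (x + 1 / ε) * d1 x)
      (Set.Icc 0 1) := by fun_prop
  obtain ⟨C, hC⟩ := isCompact_Icc.exists_bound_of_continuousOn hH
  have E : Set.EqOn (slExpr ε f)
      (fun x : ℝ => -(x : ℂ) * ((1 - (x : ℂ) ^ 2) * d2 x - 2 * (x + 1 / ε) * d1 x))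
      (Set.Ioo 0 1) := by
    intro x hx
    simp only [slExpr_eq ε f hx, E1 hx, E2 x hx]
  have hc : Continuous (fun x : ℝ => -(x : ℂ)) := by fun_prop
  refine memLp_of_bound ε hε (C := C) ?_ ?_
  · exact (hc.continuousOn.mul (hH.mono Set.Ioo_subset_Icc_self)).congr E
  · intro x hx
    rw [E hx, norm_mul, norm_neg, Complex.norm_real, Real.norm_eq_abs, abs_of_pos hx.1, mul_comm]
    exact mul_le_mul_of_nonneg_right (hC x (Set.Ioo_subset_Icc_self hx)) hx.1.le

/-- The class in `L²((0,1), w dx)` of a function in `C_0^∞([0,1])`. -/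
noncomputable def incl (ε : ℝ) (hε : 0 < ε) : smoothZero →ₗ[ℂ] L2w ε where
  toFun f := (memLp_smoothZero ε hε f).toLp (f : ℝ → ℂ)
  map_add' _ _ := rfl
  map_smul' _ _ := rfl

theorem slExpr_add (ε : ℝ) (f g : smoothZero) {x : ℝ} (hx : x ∈ Set.Ioo (0 : ℝ) 1) :
    slExpr ε (f + g : smoothZero) x = slExpr ε f x + slExpr ε g x := by
  have h1 : ∀ᶠ t in nhds x, deriv ((f + g : smoothZero) : ℝ → ℂ) t
      = (deriv (f : ℝ → ℂ) + deriv (g : ℝ → ℂ)) t := by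
    filter_upwards [isOpen_Ioo.mem_nhds hx] with t ht
    exact deriv_add (differentiableAt_deriv f ht).1 (differentiableAt_deriv g ht).1
  have h2 := Filter.EventuallyEq.deriv_eq h1
  rw [slExpr_eq ε _ hx, slExpr_eq ε _ hx, slExpr_eq ε _ hx, h2, h1.self_of_nhds,
    deriv_add (differentiableAt_deriv f hx).2 (differentiableAt_deriv g hx).2, Pi.add_apply]
  ring

theorem slExpr_smul (ε : ℝ) (c : ℂ) (f : smoothZero) {x : ℝ} (hx : x ∈ Set.Ioo (0 : ℝ) 1) :
    slExpr ε (c • f : smoothZero) x = c * slExpr ε f x := by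
  have h1 : ∀ᶠ t in nhds x, deriv ((c • f : smoothZero) : ℝ → ℂ) t
      = (c • deriv (f : ℝ → ℂ)) t := by
    filter_upwards [isOpen_Ioo.mem_nhds hx] with t ht
    exact deriv_const_smul c (differentiableAt_deriv f ht).1
  have h2 := Filter.EventuallyEq.deriv_eq h1
  rw [slExpr_eq ε _ hx, slExpr_eq ε _ hx, h2, h1.self_of_nhds,
    deriv_const_smul c (differentiableAt_deriv f hx).2, Pi.smul_apply, smul_eq_mul, smul_eq_mul]
  ring

/-- The class in `L²((0,1), w dx)` of `-w⁻¹ (p f')'`, for `f ∈ C_0^∞([0,1])`. -/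
noncomputable def slMap (ε : ℝ) (hε : 0 < ε) : smoothZero →ₗ[ℂ] L2w ε where
  toFun f := (memLp_slExpr ε hε f).toLp (slExpr ε f)
  map_add' f g := by
    rw [← MeasureTheory.MemLp.toLp_add, MeasureTheory.MemLp.toLp_eq_toLp_iff]
    refine (ae_wMeasure_iff ε).2 ?_
    filter_upwards [MeasureTheory.ae_restrict_mem measurableSet_Ioo] with x hx
    exact slExpr_add ε f g hx
  map_smul' c f := by
    rw [RingHom.id_apply, ← MeasureTheory.MemLp.toLp_const_smul,
      MeasureTheory.MemLp.toLp_eq_toLp_iff]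
    refine (ae_wMeasure_iff ε).2 ?_
    filter_upwards [MeasureTheory.ae_restrict_mem measurableSet_Ioo] with x hx
    exact slExpr_smul ε c f hx

/-- A function in `C_0^∞([0,1])` is determined on `(0,1)` by its `L²` class. -/
theorem eqOn_zero_of_incl_eq_zero (ε : ℝ) (hε : 0 < ε) (f : smoothZero)
    (h : incl ε hε f = 0) : Set.EqOn (f : ℝ → ℂ) 0 (Set.Ioo 0 1) := by
  have h' : (f : ℝ → ℂ) =ᵐ[wMeasure ε] 0 :=
    (MeasureTheory.MemLp.toLp_eq_toLp_iff (memLp_smoothZero ε hε f)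
      MeasureTheory.MemLp.zero).1 h
  exact MeasureTheory.Measure.eqOn_Ioo_of_ae_eq MeasureTheory.volume ((ae_wMeasure_iff ε).1 h')
    (f.2.1.continuousOn.mono Set.Ioo_subset_Icc_self) continuousOn_const

theorem slMap_eq_zero (ε : ℝ) (hε : 0 < ε) (f : smoothZero) (h : incl ε hε f = 0) :
    slMap ε hε f = 0 := by
  have h0 := eqOn_zero_of_incl_eq_zero ε hε f h
  have d1 : Set.EqOn (deriv (f : ℝ → ℂ)) 0 (Set.Ioo 0 1) := by
    intro x hx
    rw [(h0.eventuallyEq_of_mem (isOpen_Ioo.mem_nhds hx)).deriv_eq]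
    exact deriv_const x 0
  have d2 : Set.EqOn (deriv (deriv (f : ℝ → ℂ))) 0 (Set.Ioo 0 1) := by
    intro x hx
    rw [(d1.eventuallyEq_of_mem (isOpen_Ioo.mem_nhds hx)).deriv_eq]
    exact deriv_const x 0
  refine (MeasureTheory.MemLp.toLp_eq_toLp_iff (memLp_slExpr ε hε f)
    MeasureTheory.MemLp.zero).2 ((ae_wMeasure_iff ε).2 ?_)
  filter_upwards [MeasureTheory.ae_restrict_mem measurableSet_Ioo] with x hx
  rw [slExpr_eq ε f hx, d1 hx, d2 hx]
  simp

/-- The operator `L f = -w⁻¹ (p f')'` on `L²((0,1), w dx)` with domain `C_0^∞([0,1])`, given by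
its graph. -/
noncomputable def L (ε : ℝ) (hε : 0 < ε) : L2w ε →ₗ.[ℂ] L2w ε :=
  (LinearMap.range ((incl ε hε).prod (slMap ε hε))).toLinearPMap

/-- The graph of `L` is indeed `{(f, -w⁻¹ (p f')') : f ∈ C_0^∞([0,1])}`. -/
theorem L_graph (ε : ℝ) (hε : 0 < ε) :
    (L ε hε).graph = LinearMap.range ((incl ε hε).prod (slMap ε hε)) := by
  refine Submodule.toLinearPMap_graph_eq _ ?_
  rintro ⟨u, v⟩ ⟨f, hf⟩ hu
  obtain ⟨rfl, rfl⟩ := Prod.mk.inj hf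
  exact slMap_eq_zero ε hε f hu

theorem L_domain (ε : ℝ) (hε : 0 < ε) :
    (L ε hε).domain = LinearMap.range (incl ε hε) := by
  rw [← LinearPMap.graph_map_fst_eq_domain, L_graph, ← LinearMap.range_comp,
    LinearMap.fst_prod]

end SturmLiouville

/-! The proof rests on an abstract principle (`LinearPMap.isClosable_and_closure_inverse`): if a
bounded injective `R` satisfies `R (T u) = u` on the domain of `T`, and `T` has dense range, then
the closure of the graph of `T` is exactly `{(R v, v)}`. Injectivity of `R` makes this the graph of
an operator, so `T` is closable and `R` inverts its closure. Here `R` is the integral operator with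
kernel `G`. Near `1`, `γ` grows at most like `(1-x)^(-1/ε)`, and near `0` it is `O(x)`; `w`
compensates both, so `γ * w` is bounded and `γ` is integrable for `w dx`. Since `G(x,y)² ≤ γ(x)
γ(y)`, the kernel is Hilbert–Schmidt, hence `R` is compact. Integration by parts gives `R L f = f`:
the boundary terms vanish because `f(0) = γ(0) = 0` and `p(1) = 0`. The range of `L` is dense
because it contains every test function on `(0,1)`, obtained by integrating `-w⁻¹(pf')' = g` twice.
Injectivity of `R` is dual to this: with the bilinear pairing, `⟨L g, R v⟩ = ⟨g, v⟩` holds on the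
dense range of `L` by formal symmetry, hence for all `v`; so `R v = 0` forces `v` to annihilate all
test functions. -/

namespace SturmLiouville
open MeasureTheory Set Filter Topology

/-! ### Compactness of Hilbert–Schmidt operators -/

/-- A square-integrable family of functionals `k x` induces a compact operator
`f ↦ (x ↦ k x f)` into `L²`. -/
theorem isCompactOperator_flip_compLpL₂ {α H : Type*} [MeasurableSpace α] {μ : Measure α}
    [NormedAddCommGroup H] [NormedSpace ℂ H] (k : Lp (H →L[ℂ] ℂ) 2 μ) :
    IsCompactOperator
      (((ContinuousLinearMap.apply ℂ ℂ (E := H)).compLpL₂ 2 μ).flip k) := by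
  set T := ((ContinuousLinearMap.apply ℂ ℂ (E := H)).compLpL₂ 2 μ).flip with hT
  -- Simple functions `k` give finite-rank operators: `c` times the indicator of `s` gives the
  -- rank-one map `f ↦ c f • 1_s`. The general case follows because `T` is continuous and compact
  -- operators form a closed set.
  refine Lp.induction (by simp) (motive := fun k => IsCompactOperator (T k)) ?_ ?_ ?_ k
  · intro c s hs hμs
    have e : T (Lp.simpleFunc.indicatorConst 2 hs hμs.ne c : Lp (H →L[ℂ] ℂ) 2 μ) =
        c.smulRight (indicatorConstLp 2 hs hμs.ne (1 : ℂ)) := by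
      ext1 f
      rw [Lp.simpleFunc.coe_indicatorConst]
      refine Lp.ext ?_
      have h1 := ContinuousLinearMap.coeFn_compLp (ContinuousLinearMap.apply ℂ ℂ f)
        (indicatorConstLp 2 hs hμs.ne c)
      have h2 := Lp.coeFn_smul (c f) (indicatorConstLp 2 hs hμs.ne (1 : ℂ))
      filter_upwards [h1, h2, indicatorConstLp_coeFn (p := 2) (hs := hs) (hμs := hμs.ne) (c := c),
        indicatorConstLp_coeFn (p := 2) (hs := hs) (hμs := hμs.ne) (c := (1 : ℂ))]
        with x h1 h2 h3 h4
      simp only [hT, ContinuousLinearMap.flip_apply, ContinuousLinearMap.compLpL₂_apply_apply,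
        ContinuousLinearMap.smulRight_apply]
      rw [h1, h2, Pi.smul_apply, h3, h4]
      by_cases hx : x ∈ s <;> simp [hx]
    rw [e]
    exact (isCompactOperator_of_locallyCompactSpace_dom c).clm_comp
      ((ContinuousLinearMap.id ℂ ℂ).smulRight (indicatorConstLp 2 hs hμs.ne (1 : ℂ)))
  · intro f g hf hg _ h1 h2
    rw [map_add]
    exact h1.add h2
  · exact isClosed_setOfPred_isCompactOperator.preimage T.continuous

/-! ### The coefficient `p` and the growth of `γ` -/

/-- The larger interval `(-1,1)` makes `0` an interior point, so that regularity up to the endpoint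
`0` comes from two-sided statements. -/
theorem continuousOn_p (ε : ℝ) : ContinuousOn (p ε) (Ioo (-1) 1) := by
  intro x hx
  have h1 : 1 - x ≠ 0 := by linarith [hx.2]
  have h2 : x + 1 ≠ 0 := by linarith [hx.1]
  unfold p
  exact ((ContinuousAt.rpow_const (by fun_prop) (Or.inl h1)).mul
    (ContinuousAt.rpow_const (by fun_prop) (Or.inl h2))).continuousWithinAt

theorem p_pos (ε : ℝ) {x : ℝ} (hx : x ∈ Ioo (-1 : ℝ) 1) : 0 < p ε x := by
  have h1 : 0 < 1 - x := by linarith [hx.2]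
  have h2 : 0 < x + 1 := by linarith [hx.1]
  unfold p
  positivity

theorem contDiffOn_p (ε : ℝ) : ContDiffOn ℝ ∞ (p ε) (Ioo (-1) 1) := by
  unfold p
  refine ContDiffOn.mul ?_ ?_
  · exact ContDiffOn.rpow_const_of_ne (by fun_prop) fun x hx => by linarith [hx.2]
  · exact ContDiffOn.rpow_const_of_ne (by fun_prop) fun x hx => by linarith [hx.1]

theorem continuousOn_p_inv (ε : ℝ) : ContinuousOn (fun x => (p ε x)⁻¹) (Ioo (-1) 1) :=
  (continuousOn_p ε).inv₀ fun _ hx => (p_pos ε hx).ne'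

theorem uIcc_zero_subset {x : ℝ} (hx : x ∈ Ioo (-1 : ℝ) 1) : uIcc 0 x ⊆ Ioo (-1 : ℝ) 1 :=
  (convex_Ioo (-1 : ℝ) 1).ordConnected.uIcc_subset (by simp) hx

theorem hasDerivAt_γ (ε : ℝ) {x : ℝ} (hx : x ∈ Ioo (-1 : ℝ) 1) :
    HasDerivAt (γ ε) (p ε x)⁻¹ x := by
  have hc := continuousOn_p_inv ε
  exact intervalIntegral.integral_hasDerivAt_right
    ((hc.mono (uIcc_zero_subset hx)).intervalIntegrable)
    (hc.stronglyMeasurableAtFilter isOpen_Ioo x hx) (hc.continuousAt (isOpen_Ioo.mem_nhds hx))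

theorem γ_zero (ε : ℝ) : γ ε 0 = 0 := by simp [γ]

theorem continuousOn_γ (ε : ℝ) : ContinuousOn (γ ε) (Ioo (-1) 1) :=
  fun _ hx => (hasDerivAt_γ ε hx).continuousAt.continuousWithinAt

theorem Ico_subset_Ioo_neg_one : Ico (0 : ℝ) 1 ⊆ Ioo (-1) 1 := fun _ hx => ⟨by linarith [hx.1], hx.2⟩

theorem Ioo_subset_Ioo_neg_one : Ioo (0 : ℝ) 1 ⊆ Ioo (-1) 1 := Ioo_subset_Ioo_left (by simp)

theorem strictMonoOn_γ (ε : ℝ) : StrictMonoOn (γ ε) (Ioo (-1) 1) := by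
  refine strictMonoOn_of_deriv_pos (convex_Ioo _ _) (continuousOn_γ ε) fun x hx => ?_
  rw [interior_Ioo] at hx
  rw [(hasDerivAt_γ ε hx).deriv]
  exact inv_pos.2 (p_pos ε hx)

theorem γ_nonneg (ε : ℝ) {x : ℝ} (hx : x ∈ Ico (0 : ℝ) 1) : 0 ≤ γ ε x := by
  rw [← γ_zero ε]
  exact (strictMonoOn_γ ε).monotoneOn (by simp) (Ico_subset_Ioo_neg_one hx) hx.1

/-- Both sides vanish at `0`, so it is enough to compare derivatives. With `a = 1/ε`, the factor
`2^a` bounds `(1+y)^(a-1)`, and the factor `2` compensates `1 - y + y a ≥ 1/2`, a convex combination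
of `1` and `a > 1/2`. -/
theorem γ_le {ε : ℝ} (hε : 0 < ε) (hε2 : ε < 2) {x : ℝ} (hx : x ∈ Ico (0 : ℝ) 1) :
    γ ε x ≤ 2 * 2 ^ (1 / ε) * (x * (1 - x) ^ (-(1 / ε))) := by
  have ha : 1 / 2 < 1 / ε := one_div_lt_one_div_of_lt hε hε2
  set a := 1 / ε with ha'
  have hd : ∀ y ∈ Ioo (-1 : ℝ) 1, HasDerivAt
      (fun y => 2 * 2 ^ a * (y * (1 - y) ^ (-a)) - γ ε y)
      (2 * 2 ^ a * ((1 - y) ^ (-a) + y * (a * (1 - y) ^ (-a - 1))) - (p ε y)⁻¹) y := by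
    intro y hy
    have h1 : 0 < 1 - y := by linarith [hy.2]
    have A := ((hasDerivAt_id y).const_sub 1).rpow_const (p := -a) (Or.inl h1.ne')
    have B := (((hasDerivAt_id y).mul A).const_mul (2 * 2 ^ a)).sub (hasDerivAt_γ ε hy)
    refine B.congr_deriv ?_
    simp only [id]
    ring
  have hm : MonotoneOn (fun y => 2 * 2 ^ a * (y * (1 - y) ^ (-a)) - γ ε y) (Ico 0 1) := by
    refine monotoneOn_of_deriv_nonneg (convex_Ico _ _)
      (fun y hy => (hd y (Ico_subset_Ioo_neg_one hy)).continuousAt.continuousWithinAt)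
      (fun y hy => ?_) fun y hy => ?_
    all_goals rw [interior_Ico] at hy
    · exact (hd y (Ioo_subset_Ioo_neg_one hy)).differentiableAt.differentiableWithinAt
    · rw [(hd y (Ioo_subset_Ioo_neg_one hy)).deriv]
      have h1 : 0 < 1 - y := by linarith [hy.2]
      have h2 : 0 < y + 1 := by linarith [hy.1]
      have e1 : (1 - y) ^ (-a) = (1 - y) * (1 - y) ^ (-a - 1) := by
        rw [← Real.rpow_one_add' h1.le (by linarith)]
        ring_nf
      have e2 : (p ε y)⁻¹ = (1 - y) ^ (-a - 1) * (y + 1) ^ (a - 1) := by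
        unfold p
        rw [mul_inv, ← Real.rpow_neg h1.le, ← Real.rpow_neg h2.le, ← ha']
        ring_nf
      -- Raising the exponent to `a` first covers the case `a < 1`, where `(y+1)^(a-1)` is
      -- decreasing in `y`.
      have e3 : (y + 1) ^ (a - 1) ≤ 2 ^ a :=
        (Real.rpow_le_rpow_of_exponent_le (by linarith [hy.1]) (by linarith)).trans
          (Real.rpow_le_rpow h2.le (by linarith [hy.2]) (by linarith))
      rw [e1, e2]
      have hB : 0 < (1 - y) ^ (-a - 1) := by positivity
      have hK : 0 < (2 : ℝ) ^ a := by positivity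
      have h3 : 1 ≤ 2 * (1 - y + y * a) := by nlinarith [hy.1, hy.2]
      have h4 : (1 - y) ^ (-a - 1) * (y + 1) ^ (a - 1) ≤ (1 - y) ^ (-a - 1) * 2 ^ a := by gcongr
      have h5 : (1 - y) ^ (-a - 1) * 2 ^ a * 1 ≤
        (1 - y) ^ (-a - 1) * 2 ^ a * (2 * (1 - y + y * a)) := by gcongr
      linarith
  have := hm (left_mem_Ico.2 one_pos) hx hx.1
  simp only [γ_zero, zero_mul, mul_zero, sub_zero] at this
  linarith

theorem γ_mul_w_le {ε : ℝ} (hε : 0 < ε) (hε2 : ε < 2) {x : ℝ} (hx : x ∈ Ioo (0 : ℝ) 1) :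
    γ ε x * w ε x ≤ 2 * 2 ^ (1 / ε) := by
  have h1 : 0 < 1 - x := by linarith [hx.2]
  have h2 : 0 < x + 1 := by linarith [hx.1]
  have hx0 := hx.1
  calc γ ε x * w ε x ≤ 2 * 2 ^ (1 / ε) * (x * (1 - x) ^ (-(1 / ε))) * w ε x := by
        gcongr
        · exact (w_pos ε hx).le
        · exact γ_le hε hε2 ⟨hx.1.le, hx.2⟩
    _ = 2 * 2 ^ (1 / ε) * (x + 1) ^ (-(1 / ε)) := by
        unfold w
        rw [Real.rpow_neg h1.le]
        have : (1 - x) ^ (1 / ε) ≠ 0 := by positivity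
        field_simp
    _ ≤ 2 * 2 ^ (1 / ε) * 1 := by
        gcongr
        have : 0 < 1 / ε := by positivity
        exact Real.rpow_le_one_of_one_le_of_nonpos (by linarith) (by linarith)
    _ = _ := by ring

/-! ### Integration against `w dx` -/

/-- The total mass is infinite, as `w` behaves like `1/x` at `0`; σ-finiteness is what the product
measure needs. -/
instance (ε : ℝ) : SigmaFinite (wMeasure ε) := by
  unfold wMeasure
  exact SigmaFinite.withDensity_of_ne_top (ae_of_all _ (by simp))

theorem ae_mem_Ioo (ε : ℝ) : ∀ᵐ x ∂(wMeasure ε), x ∈ Ioo (0 : ℝ) 1 :=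
  (ae_wMeasure_iff ε).2 (ae_restrict_mem measurableSet_Ioo)

theorem ContinuousOn.aestronglyMeasurable_wMeasure {E : Type*} [TopologicalSpace E]
    [TopologicalSpace.PseudoMetrizableSpace E] (ε : ℝ) {g : ℝ → E}
    (hg : ContinuousOn g (Ioo 0 1)) : AEStronglyMeasurable g (wMeasure ε) :=
  (hg.aestronglyMeasurable measurableSet_Ioo).mono_ac (withDensity_absolutelyContinuous _ _)

theorem integrable_wMeasure_iff {E : Type*} [NormedAddCommGroup E] [NormedSpace ℝ E] (ε : ℝ)
    {g : ℝ → E} : Integrable g (wMeasure ε) ↔ IntegrableOn (fun x => w ε x • g x) (Ioo 0 1) := by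
  unfold wMeasure
  rw [integrable_withDensity_iff_integrable_smul' (measurable_w ε).ennreal_ofReal (by simp)]
  refine integrable_congr ?_
  filter_upwards [ae_restrict_mem measurableSet_Ioo] with x hx
  rw [ENNReal.toReal_ofReal (w_pos ε hx).le]

theorem integral_wMeasure {E : Type*} [NormedAddCommGroup E] [NormedSpace ℝ E] (ε : ℝ)
    (g : ℝ → E) : ∫ x, g x ∂(wMeasure ε) = ∫ x in Ioo 0 1, w ε x • g x := by
  unfold wMeasure
  rw [integral_withDensity_eq_integral_toReal_smul (measurable_w ε).ennreal_ofReal (by simp)]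
  refine integral_congr_ae ?_
  filter_upwards [ae_restrict_mem measurableSet_Ioo] with x hx
  rw [ENNReal.toReal_ofReal (w_pos ε hx).le]

theorem integrable_γ {ε : ℝ} (hε : 0 < ε) (hε2 : ε < 2) : Integrable (γ ε) (wMeasure ε) := by
  rw [integrable_wMeasure_iff]
  have hf : IsFiniteMeasure (volume.restrict (Ioo (0 : ℝ) 1)) := ⟨by simp⟩
  refine Integrable.of_bound (C := 2 * 2 ^ (1 / ε)) ?_ ?_
  · exact (measurable_w ε).aestronglyMeasurable.smul
      (((continuousOn_γ ε).mono Ioo_subset_Ioo_neg_one).aestronglyMeasurable measurableSet_Ioo)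
  · filter_upwards [ae_restrict_mem measurableSet_Ioo] with x hx
    have h := γ_nonneg ε (Ioo_subset_Ico_self hx)
    have h' := (w_pos ε hx).le
    rw [smul_eq_mul, Real.norm_eq_abs, abs_of_nonneg (by positivity), mul_comm]
    exact γ_mul_w_le hε hε2 hx

/-! ### Square-integrability of the kernel -/

theorem min_mem_Ico {x y : ℝ} (hx : x ∈ Ico (0 : ℝ) 1) (hy : y ∈ Ico (0 : ℝ) 1) :
    min x y ∈ Ico (0 : ℝ) 1 :=
  ⟨le_min hx.1 hy.1, (min_le_left _ _).trans_lt hx.2⟩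

theorem G_nonneg (ε : ℝ) {x y : ℝ} (hx : x ∈ Ico (0 : ℝ) 1) (hy : y ∈ Ico (0 : ℝ) 1) :
    0 ≤ G ε x y := γ_nonneg ε (min_mem_Ico hx hy)

theorem G_eq_min (ε : ℝ) {x y : ℝ} (hx : x ∈ Ico (0 : ℝ) 1) (hy : y ∈ Ico (0 : ℝ) 1) :
    G ε x y = min (γ ε x) (γ ε y) :=
  (strictMonoOn_γ ε).monotoneOn.map_min (Ico_subset_Ioo_neg_one hx) (Ico_subset_Ioo_neg_one hy)

theorem G_sq_le (ε : ℝ) {x y : ℝ} (hx : x ∈ Ico (0 : ℝ) 1) (hy : y ∈ Ico (0 : ℝ) 1) :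
    G ε x y ^ 2 ≤ γ ε x * γ ε y := by
  have h := G_nonneg ε hx hy
  rw [G_eq_min ε hx hy] at *
  rw [sq]
  exact mul_le_mul (min_le_left _ _) (min_le_right _ _) h (γ_nonneg ε hx)

/-- One factor is bounded by `|γ x - γ x'|`, as `min` is 1-Lipschitz, and the other by `γ y`. The
product is small as `x' → x` and still integrable in `y`. -/
theorem G_sub_sq_le (ε : ℝ) {x x' y : ℝ} (hx : x ∈ Ico (0 : ℝ) 1) (hx' : x' ∈ Ico (0 : ℝ) 1)
    (hy : y ∈ Ico (0 : ℝ) 1) :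
    (G ε x y - G ε x' y) ^ 2 ≤ |γ ε x - γ ε x'| * γ ε y := by
  have h1 : |G ε x y - G ε x' y| ≤ |γ ε x - γ ε x'| := by
    rw [G_eq_min ε hx hy, G_eq_min ε hx' hy]
    have := abs_min_sub_min_le_max (γ ε x) (γ ε y) (γ ε x') (γ ε y)
    simpa using this
  have h2 : |G ε x y - G ε x' y| ≤ γ ε y := by
    have a := G_nonneg ε hx hy
    have b := G_nonneg ε hx' hy
    have a' : G ε x y ≤ γ ε y := by rw [G_eq_min ε hx hy]; exact min_le_right _ _
    have b' : G ε x' y ≤ γ ε y := by rw [G_eq_min ε hx' hy]; exact min_le_right _ _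
    rw [abs_le]
    constructor <;> linarith
  rw [← sq_abs, sq]
  exact mul_le_mul h1 h2 (abs_nonneg _) (abs_nonneg _)

theorem memLp_G {ε : ℝ} (hε : 0 < ε) (hε2 : ε < 2) :
    MemLp (fun z : ℝ × ℝ => G ε z.1 z.2) 2 ((wMeasure ε).prod (wMeasure ε)) := by
  have hae : ∀ᵐ z ∂((wMeasure ε).prod (wMeasure ε)), z.1 ∈ Ioo (0 : ℝ) 1 ∧ z.2 ∈ Ioo (0 : ℝ) 1 :=
    (Measure.quasiMeasurePreserving_fst.ae (ae_mem_Ioo ε)).and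
      (Measure.quasiMeasurePreserving_snd.ae (ae_mem_Ioo ε))
  have hm : AEStronglyMeasurable (fun z : ℝ × ℝ => G ε z.1 z.2)
      ((wMeasure ε).prod (wMeasure ε)) := by
    -- Continuity of `γ` is known only on `(-1,1)`; extending by `0` gives a measurable function
    -- that agrees with it at almost every value of `min z.1 z.2`.
    have h : Measurable ((Ioo (-1 : ℝ) 1).piecewise (γ ε) 0) :=
      (continuousOn_γ ε).measurable_piecewise continuousOn_const measurableSet_Ioo
    refine ⟨fun z => (Ioo (-1 : ℝ) 1).piecewise (γ ε) 0 (min z.1 z.2),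
      (h.comp (measurable_fst.min measurable_snd)).stronglyMeasurable, ?_⟩
    filter_upwards [hae] with z hz
    have := Ico_subset_Ioo_neg_one
      (min_mem_Ico (Ioo_subset_Ico_self hz.1) (Ioo_subset_Ico_self hz.2))
    rw [piecewise_eq_of_mem _ _ _ this, G]
  rw [memLp_two_iff_integrable_sq_norm hm]
  refine ((integrable_γ hε hε2).mul_prod (integrable_γ hε hε2)).mono' (hm.norm.pow 2) ?_
  filter_upwards [hae] with z hz
  rw [norm_pow, norm_norm, Real.norm_eq_abs, sq_abs]
  exact G_sq_le ε (Ioo_subset_Ico_self hz.1) (Ioo_subset_Ico_self hz.2)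

theorem continuousOn_G (ε : ℝ) {x : ℝ} (hx : x ∈ Ico (0 : ℝ) 1) :
    ContinuousOn (G ε x) (Ico 0 1) :=
  (continuousOn_γ ε).comp (by fun_prop)
    fun _ hy => Ico_subset_Ioo_neg_one (min_mem_Ico hx hy)

theorem memLp_G_slice {ε : ℝ} (hε : 0 < ε) (hε2 : ε < 2) {x : ℝ} (hx : x ∈ Ico (0 : ℝ) 1) :
    MemLp (fun y => (G ε x y : ℂ)) 2 (wMeasure ε) := by
  have hm : AEStronglyMeasurable (fun y => (G ε x y : ℂ)) (wMeasure ε) :=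
    Complex.continuous_ofReal.comp_aestronglyMeasurable
      (ContinuousOn.aestronglyMeasurable_wMeasure ε
        ((continuousOn_G ε hx).mono Ioo_subset_Ico_self))
  rw [memLp_two_iff_integrable_sq_norm hm]
  refine ((integrable_γ hε hε2).const_mul (γ ε x)).mono' (hm.norm.pow 2) ?_
  filter_upwards [ae_mem_Ioo ε] with y hy
  rw [norm_pow, norm_norm, Complex.norm_real, Real.norm_eq_abs, sq_abs]
  exact G_sq_le ε hx (Ioo_subset_Ico_self hy)

theorem _root_.MeasureTheory.MemLp.integrable_sq_norm {α : Type*} [MeasurableSpace α]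
    {μ : Measure α} {g : α → ℂ} (hg : MemLp g 2 μ) : Integrable (fun x => ‖g x‖ ^ 2) μ :=
  (memLp_two_iff_integrable_sq_norm hg.1).1 hg

theorem norm_toLp_sq {α : Type*} [MeasurableSpace α] {μ : Measure α} {g : α → ℂ}
    (hg : MemLp g 2 μ) : ‖hg.toLp g‖ ^ 2 = ∫ x, ‖g x‖ ^ 2 ∂μ := by
  have h : ((‖hg.toLp g‖ ^ 2 : ℝ) : ℂ) = ((∫ x, ‖g x‖ ^ 2 ∂μ : ℝ) : ℂ) := by
    push_cast
    rw [← RCLike.ofReal_eq_complex_ofReal, ← inner_self_eq_norm_sq_to_K (𝕜 := ℂ), L2.inner_def]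
    refine Eq.trans (integral_congr_ae ?_) (integral_ofReal (𝕜 := ℂ))
    filter_upwards [hg.coeFn_toLp] with x hx
    rw [hx, inner_self_eq_norm_sq_to_K]
    simp
  exact_mod_cast h

/-! ### The Green operator -/

open Classical in
/-- The section `G(x, ·)` of the kernel as an element of `L²((0,1), w dx)`. -/
noncomputable def kernelSlice (ε x : ℝ) : L2w ε :=
  if h : MemLp (fun y => (G ε x y : ℂ)) 2 (wMeasure ε) then h.toLp _ else 0

theorem kernelSlice_eq {ε : ℝ} (hε : 0 < ε) (hε2 : ε < 2) {x : ℝ} (hx : x ∈ Ico (0 : ℝ) 1) :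
    kernelSlice ε x = (memLp_G_slice hε hε2 hx).toLp _ := dif_pos _

theorem norm_kernelSlice_sq_le {ε : ℝ} (hε : 0 < ε) (hε2 : ε < 2) {x : ℝ}
    (hx : x ∈ Ico (0 : ℝ) 1) :
    ‖kernelSlice ε x‖ ^ 2 ≤ γ ε x * ∫ y, γ ε y ∂(wMeasure ε) := by
  rw [kernelSlice_eq hε hε2 hx, norm_toLp_sq, ← integral_const_mul]
  refine integral_mono_ae (memLp_G_slice hε hε2 hx).integrable_sq_norm
    ((integrable_γ hε hε2).const_mul _) ?_
  filter_upwards [ae_mem_Ioo ε] with y hy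
  rw [Complex.norm_real, Real.norm_eq_abs, sq_abs]
  exact G_sq_le ε hx (Ioo_subset_Ico_self hy)

theorem norm_kernelSlice_sub_sq_le {ε : ℝ} (hε : 0 < ε) (hε2 : ε < 2) {x x' : ℝ}
    (hx : x ∈ Ico (0 : ℝ) 1) (hx' : x' ∈ Ico (0 : ℝ) 1) :
    ‖kernelSlice ε x - kernelSlice ε x'‖ ^ 2 ≤
      |γ ε x - γ ε x'| * ∫ y, γ ε y ∂(wMeasure ε) := by
  have hm := (memLp_G_slice hε hε2 hx).sub (memLp_G_slice hε hε2 hx')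
  rw [kernelSlice_eq hε hε2 hx, kernelSlice_eq hε hε2 hx', ← MemLp.toLp_sub, norm_toLp_sq,
    ← integral_const_mul]
  refine integral_mono_ae hm.integrable_sq_norm ((integrable_γ hε hε2).const_mul _) ?_
  filter_upwards [ae_mem_Ioo ε] with y hy
  rw [Pi.sub_apply, ← Complex.ofReal_sub, Complex.norm_real, Real.norm_eq_abs, sq_abs]
  exact G_sub_sq_le ε hx hx' (Ioo_subset_Ico_self hy)

/-- This supplies the strong measurability of the Hilbert-space-valued map `x ↦ G(x, ·)`. -/
theorem continuousOn_kernelSlice {ε : ℝ} (hε : 0 < ε) (hε2 : ε < 2) :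
    ContinuousOn (kernelSlice ε) (Ico 0 1) := by
  intro x hx
  have hγ : Tendsto (γ ε) (𝓝[Ico 0 1] x) (𝓝 (γ ε x)) :=
    ((continuousOn_γ ε).mono Ico_subset_Ioo_neg_one) x hx
  have h : Tendsto (fun t => √(|γ ε t - γ ε x| * ∫ y, γ ε y ∂(wMeasure ε)))
      (𝓝[Ico 0 1] x) (𝓝 0) := by
    have := (((hγ.sub_const (γ ε x)).abs).mul_const (∫ y, γ ε y ∂(wMeasure ε))).sqrt
    simpa using this
  refine tendsto_iff_norm_sub_tendsto_zero.2 (squeeze_zero' ?_ ?_ h)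
  · exact Eventually.of_forall fun _ => norm_nonneg _
  · filter_upwards [self_mem_nhdsWithin] with t ht
    exact Real.le_sqrt_of_sq_le (norm_kernelSlice_sub_sq_le hε hε2 ht hx)

theorem memLp_innerSL_kernelSlice {ε : ℝ} (hε : 0 < ε) (hε2 : ε < 2) :
    MemLp (fun x => innerSL ℂ (kernelSlice ε x)) 2 (wMeasure ε) := by
  have hm : AEStronglyMeasurable (fun x => innerSL ℂ (kernelSlice ε x)) (wMeasure ε) :=
    (innerSL ℂ).continuous.comp_aestronglyMeasurable
      (ContinuousOn.aestronglyMeasurable_wMeasure ε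
        ((continuousOn_kernelSlice hε hε2).mono Ioo_subset_Ico_self))
  rw [memLp_two_iff_integrable_sq_norm hm]
  refine ((integrable_γ hε hε2).mul_const (∫ y, γ ε y ∂(wMeasure ε))).mono' (hm.norm.pow 2) ?_
  filter_upwards [ae_mem_Ioo ε] with x hx
  rw [innerSL_apply_norm, Real.norm_eq_abs, abs_of_nonneg (sq_nonneg _)]
  exact norm_kernelSlice_sq_le hε hε2 (Ioo_subset_Ico_self hx)

/-- The integral operator on `L²((0,1), w dx)` with kernel `G`. -/
noncomputable def greenOp {ε : ℝ} (hε : 0 < ε) (hε2 : ε < 2) : L2w ε →L[ℂ] L2w ε :=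
  ((ContinuousLinearMap.apply ℂ ℂ (E := L2w ε)).compLpL₂ 2 (wMeasure ε)).flip
    ((memLp_innerSL_kernelSlice hε hε2).toLp _)

theorem isCompactOperator_greenOp {ε : ℝ} (hε : 0 < ε) (hε2 : ε < 2) :
    IsCompactOperator (greenOp hε hε2) :=
  isCompactOperator_flip_compLpL₂ _

theorem integrableOn_mul_mul_w (ε : ℝ) {u v : ℝ → ℂ} (hu : MemLp u 2 (wMeasure ε))
    (hv : MemLp v 2 (wMeasure ε)) :
    IntegrableOn (fun y => u y * v y * (w ε y : ℂ)) (Ioo 0 1) := by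
  have h := (integrable_wMeasure_iff ε).1 (hu.integrable_mul hv)
  refine h.congr (ae_of_all _ fun y => ?_)
  simp only [Pi.mul_apply, Complex.real_smul]
  ring

/-- By construction the value at `x` is the inner product of `f` with the section `G(x, ·)`; the
kernel is real, so the conjugation disappears. -/
theorem greenOp_apply {ε : ℝ} (hε : 0 < ε) (hε2 : ε < 2) (f : L2w ε) :
    ∀ᵐ x ∂(wMeasure ε), greenOp hε hε2 f x =
      ∫ y in Ioo (0 : ℝ) 1, (G ε x y : ℂ) * f y * (w ε y : ℂ) := by
  have h1 := ContinuousLinearMap.coeFn_compLp (ContinuousLinearMap.apply ℂ ℂ f)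
    ((memLp_innerSL_kernelSlice hε hε2).toLp _)
  filter_upwards [h1, (memLp_innerSL_kernelSlice hε hε2).coeFn_toLp, ae_mem_Ioo ε]
    with x h1 h2 hx
  have e : greenOp hε hε2 f x = inner ℂ (kernelSlice ε x) f := by
    rw [h2] at h1
    exact h1
  rw [e, L2.inner_def, kernelSlice_eq hε hε2 (Ioo_subset_Ico_self hx)]
  have e2 : ∫ y, inner ℂ ((memLp_G_slice hε hε2 (Ioo_subset_Ico_self hx)).toLp _ y) (f y)
      ∂(wMeasure ε) = ∫ y, (G ε x y : ℂ) * f y ∂(wMeasure ε) := by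
    refine integral_congr_ae ?_
    filter_upwards [(memLp_G_slice hε hε2 (Ioo_subset_Ico_self hx)).coeFn_toLp] with y hy
    rw [hy, RCLike.inner_apply, Complex.conj_ofReal, mul_comm]
  rw [e2, integral_wMeasure]
  refine integral_congr_ae (ae_of_all _ fun y => ?_)
  simp only [Complex.real_smul]
  ring

/-! ### Integration by parts -/

theorem hasDerivAt_p_mul_deriv (ε : ℝ) (f : smoothZero) {x : ℝ} (hx : x ∈ Ioo (0 : ℝ) 1) :
    HasDerivAt (fun t => (p ε t : ℂ) * deriv (f : ℝ → ℂ) t) (-(slExpr ε f x * (w ε x : ℂ))) x := by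
  have h := ((hasDerivAt_p ε hx).ofReal_comp.mul
    (differentiableAt_deriv f hx).2.hasDerivAt).differentiableAt.hasDerivAt
  refine h.congr_deriv ?_
  have hw : (w ε x : ℂ) ≠ 0 := by exact_mod_cast (w_pos ε hx).ne'
  rw [slExpr, mul_right_comm, neg_mul, inv_mul_cancel₀ hw, neg_one_mul, neg_neg]
  rfl

theorem continuousOn_p_Icc {ε : ℝ} (hε : 0 < ε) : ContinuousOn (p ε) (Icc 0 1) := by
  intro x hx
  have h1 : x + 1 ≠ 0 := by linarith [hx.1]
  have h2 : 0 ≤ 1 + 1 / ε := by positivity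
  unfold p
  exact ((ContinuousAt.rpow_const (f := fun x : ℝ => 1 - x) (by fun_prop) (Or.inr h2)).mul
    (ContinuousAt.rpow_const (by fun_prop) (Or.inl h1) : ContinuousAt _ x)).continuousWithinAt

theorem p_one {ε : ℝ} (hε : 0 < ε) : p ε 1 = 0 := by
  have : 1 + 1 / ε ≠ 0 := by positivity
  simp only [p, sub_self]
  rw [Real.zero_rpow this, zero_mul]

/-- The function `p f'` extends continuously to `[0,1]` and vanishes at `1`. -/
theorem exists_continuousOn_p_mul_deriv {ε : ℝ} (hε : 0 < ε) (f : smoothZero) :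
    ∃ Q : ℝ → ℂ, ContinuousOn Q (Icc 0 1) ∧ Q 1 = 0 ∧
      (∀ y ∈ Ioo (0 : ℝ) 1, Q y = p ε y * deriv (f : ℝ → ℂ) y) ∧
      ∀ y ∈ Ioo (0 : ℝ) 1, HasDerivAt Q (-(slExpr ε f y * (w ε y : ℂ))) y := by
  -- At `0` and `1`, `deriv f` depends on the irrelevant values of `f` outside `[0,1]`;
  -- `derivWithin` is continuous up to both endpoints.
  set D := derivWithin (f : ℝ → ℂ) (Icc 0 1)
  have hDc : ContinuousOn D (Icc 0 1) :=
    f.2.1.continuousOn_derivWithin (uniqueDiffOn_Icc zero_lt_one) (by simp)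
  have hDe : EqOn D (deriv (f : ℝ → ℂ)) (Ioo 0 1) :=
    fun y hy => derivWithin_of_mem_nhds (Icc_mem_nhds hy.1 hy.2)
  refine ⟨fun t => (p ε t : ℂ) * D t,
    (Complex.continuous_ofReal.comp_continuousOn (continuousOn_p_Icc hε)).mul hDc,
    by simp [p_one hε], fun y hy => by simp only [hDe hy], fun y hy => ?_⟩
  refine (hasDerivAt_p_mul_deriv ε f hy).congr_of_eventuallyEq ?_
  filter_upwards [isOpen_Ioo.mem_nhds hy] with t ht
  rw [hDe ht]

/-- The expression `-w⁻¹ (p f')'` is formally symmetric on `C_0^∞([0,1])`. -/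
theorem integral_slExpr_mul {ε : ℝ} (hε : 0 < ε) (f g : smoothZero) :
    ∫ y in Ioo (0 : ℝ) 1, (g : ℝ → ℂ) y * slExpr ε f y * (w ε y : ℂ) =
      ∫ y in Ioo (0 : ℝ) 1, slExpr ε g y * (f : ℝ → ℂ) y * (w ε y : ℂ) := by
  have i1 := integrableOn_mul_mul_w ε (memLp_smoothZero ε hε g) (memLp_slExpr ε hε f)
  have i2 := integrableOn_mul_mul_w ε (memLp_slExpr ε hε g) (memLp_smoothZero ε hε f)
  obtain ⟨P, hPc, hP1, hPe, hPd⟩ := exists_continuousOn_p_mul_deriv hε f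
  obtain ⟨Q, hQc, hQ1, hQe, hQd⟩ := exists_continuousOn_p_mul_deriv hε g
  -- The difference of the integrands is the derivative of `p (g' f - g f')`, which vanishes at `0`
  -- through `f` and `g`, and at `1` through `p`.
  rw [← sub_eq_zero, ← integral_sub i1 i2, ← integral_Ioc_eq_integral_Ioo,
    ← intervalIntegral.integral_of_le zero_le_one,
    intervalIntegral.integral_eq_sub_of_hasDerivAt_of_le
      (f := fun y => Q y * (f : ℝ → ℂ) y - (g : ℝ → ℂ) y * P y) zero_le_one
      ((hQc.mul f.2.1.continuousOn).sub (g.2.1.continuousOn.mul hPc)) (fun y hy => ?_)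
      ((intervalIntegrable_iff_integrableOn_Ioo_of_le zero_le_one).2 (by exact i1.sub i2))]
  · simp [hP1, hQ1, f.2.2, g.2.2]
  · refine (((hQd y hy).mul (differentiableAt_deriv f hy).1.hasDerivAt).sub
      ((differentiableAt_deriv g hy).1.hasDerivAt.mul (hPd y hy))).congr_deriv ?_
    rw [hPe y hy, hQe y hy]
    ring

/-- Integration by parts: `G` inverts `-w⁻¹ (p f')'` on functions in `C_0^∞([0,1])`. -/
theorem integral_G_mul_slExpr {ε : ℝ} (hε : 0 < ε) (hε2 : ε < 2) (f : smoothZero) {x : ℝ}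
    (hx : x ∈ Ioo (0 : ℝ) 1) :
    ∫ y in Ioo (0 : ℝ) 1, (G ε x y : ℂ) * slExpr ε f y * (w ε y : ℂ) = (f : ℝ → ℂ) x := by
  have hint := integrableOn_mul_mul_w ε (memLp_G_slice hε hε2 (Ioo_subset_Ico_self hx))
    (memLp_slExpr ε hε f)
  have hI0 : IntervalIntegrable (fun y => (G ε x y : ℂ) * slExpr ε f y * (w ε y : ℂ))
      volume 0 x := (intervalIntegrable_iff_integrableOn_Ioo_of_le hx.1.le).2
        (hint.mono_set (Ioo_subset_Ioo_right hx.2.le))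
  have hI1 : IntervalIntegrable (fun y => (G ε x y : ℂ) * slExpr ε f y * (w ε y : ℂ))
      volume x 1 := (intervalIntegrable_iff_integrableOn_Ioo_of_le hx.2.le).2
        (hint.mono_set (Ioo_subset_Ioo_left hx.1.le))
  obtain ⟨Q, hQc, hQ1, hQe, hQd⟩ := exists_continuousOn_p_mul_deriv hε f
  have hγc : ContinuousOn (fun t => (γ ε t : ℂ)) (Icc 0 x) :=
    Complex.continuous_ofReal.comp_continuousOn ((continuousOn_γ ε).mono fun y hy =>
      ⟨by linarith [hy.1], by linarith [hy.2, hx.2]⟩)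
  have hsub0 : Icc 0 x ⊆ Icc 0 1 := Icc_subset_Icc_right hx.2.le
  -- Below `x` the kernel is `γ y`, and since `γ' = 1/p` an antiderivative is `f - γ p f'`.
  have h0 : ∫ y in (0 : ℝ)..x, (G ε x y : ℂ) * slExpr ε f y * (w ε y : ℂ) =
      ((f : ℝ → ℂ) x - γ ε x * Q x) -
        ((f : ℝ → ℂ) 0 - γ ε 0 * Q 0) := by
    refine intervalIntegral.integral_eq_sub_of_hasDerivAt_of_le
      (f := fun y => (f : ℝ → ℂ) y - γ ε y * Q y) hx.1.le
      ((f.2.1.continuousOn.mono hsub0).sub (hγc.mul (hQc.mono hsub0))) (fun y hy => ?_) hI0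
    have hy' : y ∈ Ioo (0 : ℝ) 1 := ⟨hy.1, hy.2.trans hx.2⟩
    have hp : (p ε y : ℂ) ≠ 0 := by exact_mod_cast (p_pos ε (Ioo_subset_Ioo_neg_one hy')).ne'
    refine ((differentiableAt_deriv f hy').1.hasDerivAt.sub
      ((hasDerivAt_γ ε (Ioo_subset_Ioo_neg_one hy')).ofReal_comp.mul (hQd y hy'))).congr_deriv ?_
    rw [hQe y hy', G, min_eq_right hy.2.le]
    push_cast
    field_simp
    ring
  -- Above `x` the kernel is the constant `γ x`; the two terms containing `Q x` cancel in the sum.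
  have h1 : ∫ y in x..(1 : ℝ), (G ε x y : ℂ) * slExpr ε f y * (w ε y : ℂ) =
      -(γ ε x) * Q 1 - -(γ ε x) * Q x := by
    refine intervalIntegral.integral_eq_sub_of_hasDerivAt_of_le
      (f := fun y => -(γ ε x : ℂ) * Q y) hx.2.le
      (continuousOn_const.mul (hQc.mono (Icc_subset_Icc_left hx.1.le))) (fun y hy => ?_) hI1
    refine ((hQd y ⟨hx.1.trans hy.1, hy.2⟩).const_mul _).congr_deriv ?_
    rw [G, min_eq_left hy.1.le]
    ring
  rw [← integral_Ioc_eq_integral_Ioo, ← intervalIntegral.integral_of_le zero_le_one,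
    ← intervalIntegral.integral_add_adjacent_intervals hI0 hI1, h0, h1, hQ1, γ_zero, f.2.2]
  push_cast
  ring

theorem greenOp_slMap {ε : ℝ} (hε : 0 < ε) (hε2 : ε < 2) (f : smoothZero) :
    greenOp hε hε2 (slMap ε hε f) = incl ε hε f := by
  refine Lp.ext ?_
  have h1 : incl ε hε f =ᵐ[wMeasure ε] (f : ℝ → ℂ) := (memLp_smoothZero ε hε f).coeFn_toLp
  have h2 : slMap ε hε f =ᵐ[wMeasure ε] slExpr ε f := (memLp_slExpr ε hε f).coeFn_toLp
  filter_upwards [greenOp_apply hε hε2 (slMap ε hε f), h1, ae_mem_Ioo ε] with x hx h1 hx'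
  rw [hx, h1, ← integral_G_mul_slExpr hε hε2 f hx']
  refine integral_congr_ae ?_
  filter_upwards [(ae_wMeasure_iff ε).1 h2] with y hy
  rw [hy]

/-! ### Test functions and density of the range -/

theorem contDiff_mul_w (ε : ℝ) {g : ℝ → ℝ} (hg : ContDiff ℝ ∞ g)
    (hgs : tsupport g ⊆ Ioo 0 1) : ContDiff ℝ ∞ (fun t => g t * w ε t) := by
  refine contDiff_iff_contDiffAt.2 fun t => ?_
  by_cases ht : t ∈ tsupport g
  swap
  · refine (contDiffAt_const (c := (0 : ℝ))).congr_of_eventuallyEq ?_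
    filter_upwards [notMem_tsupport_iff_eventuallyEq.1 ht] with s hs
    rw [hs, Pi.zero_apply, zero_mul]
  have ht' := hgs ht
  refine hg.contDiffAt.mul ?_
  unfold w
  refine ((contDiffAt_id.inv ht'.1.ne').mul ?_).mul ?_
  · exact ContDiffAt.rpow_const_of_ne (by fun_prop) (by linarith [ht'.2])
  · exact ContDiffAt.rpow_const_of_ne (by fun_prop) (by linarith [ht'.1])

/-- Every test function on `(0,1)` is of the form `-w⁻¹ (p f')'` with `f ∈ C_0^∞([0,1])`. -/
theorem exists_slExpr_eq (ε : ℝ) {g : ℝ → ℝ} (hg : ContDiff ℝ ∞ g)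
    (hgs : tsupport g ⊆ Ioo 0 1) :
    ∃ f : smoothZero, ∀ x ∈ Ioo (0 : ℝ) 1, slExpr ε f x = g x := by
  have hq := contDiff_mul_w ε hg hgs
  obtain ⟨b, hb, hbg⟩ : ∃ b < 1, ∀ t, b < t → g t = 0 := by
    obtain ⟨δ, hδ, hball⟩ := Metric.isOpen_iff.1 (isClosed_tsupport g).isOpen_compl 1
      (fun h => lt_irrefl _ (hgs h).2)
    refine ⟨1 - δ, by linarith, fun t ht => image_eq_zero_of_notMem_tsupport fun hmem => ?_⟩
    refine hball ?_ hmem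
    rw [Metric.mem_ball, Real.dist_eq, abs_lt]
    constructor <;> linarith [(hgs hmem).2]
  set q := fun t => g t * w ε t with hq_def
  -- `P` plays the role of `p f'`. Integrating from `1` makes it vanish on `(b, ∞)`, which removes
  -- the singularity of `p⁻¹` at `1`.
  set P := fun t => -∫ s in (1 : ℝ)..t, q s with hP
  have hPd : ∀ t, HasDerivAt P (-q t) t := fun t =>
    (hq.continuous.integral_hasStrictDerivAt 1 t).hasDerivAt.neg
  have hPs : ContDiff ℝ ∞ P := by
    rw [contDiff_infty_iff_deriv]
    refine ⟨fun t => (hPd t).differentiableAt, ?_⟩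
    rw [funext fun t => (hPd t).deriv]
    exact hq.neg
  have hP0 : ∀ t, b < t → P t = 0 := by
    intro t ht
    rw [hP]
    simp only [neg_eq_zero]
    rw [intervalIntegral.integral_congr (g := fun _ => 0), intervalIntegral.integral_zero]
    intro s hs
    have : b < s := (lt_min hb ht).trans_le hs.1
    simp [hq_def, hbg s this]
  have hhs : ContDiffOn ℝ ∞ (fun t => (p ε t)⁻¹ * P t) (Ioi (-1)) := by
    intro t ht
    by_cases h1 : t < 1
    · have hn : Ioo (-1 : ℝ) 1 ∈ 𝓝 t := isOpen_Ioo.mem_nhds ⟨ht, h1⟩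
      exact (((contDiffOn_p ε).contDiffAt hn).inv (p_pos ε ⟨ht, h1⟩).ne').mul
        hPs.contDiffAt |>.contDiffWithinAt
    · refine ContDiffAt.contDiffWithinAt
        ((contDiffAt_const (c := (0 : ℝ))).congr_of_eventuallyEq ?_)
      filter_upwards [Ioi_mem_nhds (show b < t by linarith)] with s hs
      rw [hP0 s hs, mul_zero]
  set h := fun t => (p ε t)⁻¹ * P t with hh
  -- The solution: `F' = P / p` with `F(0) = 0`. It is smooth on `(-1, ∞)`, hence up to both
  -- endpoints of `[0,1]`.
  set F := fun x => ∫ t in (0 : ℝ)..x, h t with hF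
  have hFd : ∀ x ∈ Ioi (-1 : ℝ), HasDerivAt F (h x) x := by
    intro x hx
    have hc := hhs.continuousOn
    have hsub : uIcc 0 x ⊆ Ioi (-1 : ℝ) := ordConnected_Ioi.uIcc_subset (by simp) hx
    exact intervalIntegral.integral_hasDerivAt_right ((hc.mono hsub).intervalIntegrable)
      (hc.stronglyMeasurableAtFilter isOpen_Ioi x hx) (hc.continuousAt (isOpen_Ioi.mem_nhds hx))
  have hFs : ContDiffOn ℝ ∞ F (Ioi (-1)) := by
    rw [contDiffOn_infty_iff_deriv_of_isOpen isOpen_Ioi]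
    exact ⟨fun x hx => (hFd x hx).differentiableAt.differentiableWithinAt,
      hhs.congr fun x hx => (hFd x hx).deriv⟩
  refine ⟨⟨fun x => (F x : ℂ), ?_, ?_⟩, fun x hx => ?_⟩
  · exact Complex.ofRealCLM.contDiff.comp_contDiffOn
      (hFs.mono fun x hx => by rw [mem_Ioi]; linarith [hx.1])
  · simp [hF]
  · have e : (fun t => (p ε t : ℂ) * deriv (fun x => (F x : ℂ)) t) =ᶠ[𝓝 x]
        fun t => (P t : ℂ) := by
      filter_upwards [isOpen_Ioo.mem_nhds hx] with t ht
      have ht' := Ioo_subset_Ioo_neg_one ht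
      have hp : (p ε t : ℂ) ≠ 0 := by exact_mod_cast (p_pos ε ht').ne'
      rw [(hFd t ht'.1).ofReal_comp.deriv, hh]
      push_cast
      field_simp
    have hw : (w ε x : ℂ) ≠ 0 := by exact_mod_cast (w_pos ε hx).ne'
    rw [slExpr, e.deriv_eq, (hPd x).ofReal_comp.deriv, hq_def]
    push_cast
    field_simp

/-- An element of `L²((0,1), w dx)` that annihilates all test functions vanishes. -/
theorem eq_zero_of_forall_integral_testFunction {ε : ℝ} (hε : 0 < ε) (u : L2w ε)
    (h : ∀ g : ℝ → ℝ, ContDiff ℝ ∞ g → tsupport g ⊆ Ioo 0 1 →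
      ∫ y in Ioo (0 : ℝ) 1, (g y : ℂ) * u y * (w ε y : ℂ) = 0) : u = 0 := by
  -- Constants are not in `L²(w dx)`, so `u w` need not be integrable at `0`. The function `x` is in
  -- `L²(w dx)`, so `x u w` is integrable, and the extra factor `x` is absorbed into the test
  -- function.
  have hid : MemLp (fun x : ℝ => (x : ℂ)) 2 (wMeasure ε) := by
    refine memLp_of_bound ε hε (C := 1) (by fun_prop) fun x hx => ?_
    rw [Complex.norm_real, Real.norm_eq_abs, abs_of_pos hx.1, one_mul]
  have hint := integrableOn_mul_mul_w ε hid (Lp.memLp u)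
  have hz := IsOpen.ae_eq_zero_of_integral_contDiff_smul_eq_zero (μ := volume)
    (isOpen_Ioo (a := (0 : ℝ)) (b := 1)) hint.locallyIntegrableOn ?_
  · refine (Lp.eq_zero_iff_ae_eq_zero).2 ((ae_wMeasure_iff ε).2 ?_)
    rw [ae_restrict_iff' measurableSet_Ioo]
    filter_upwards [hz] with x hx hx'
    have hw : (w ε x : ℂ) ≠ 0 := by exact_mod_cast (w_pos ε hx').ne'
    have hx0 : (x : ℂ) ≠ 0 := by exact_mod_cast hx'.1.ne'
    simpa [hw, hx0] using hx hx'
  · intro g hg _ hgs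
    have hgs' : tsupport (fun x => g x * x) ⊆ Ioo 0 1 := tsupport_mul_subset_left.trans hgs
    rw [← setIntegral_eq_integral_of_forall_compl_eq_zero (s := Ioo (0 : ℝ) 1),
      ← h _ (hg.mul contDiff_id) hgs']
    · refine integral_congr_ae (ae_of_all _ fun x => ?_)
      simp only [Complex.real_smul, id]
      push_cast
      ring
    · intro x hx
      rw [image_eq_zero_of_notMem_tsupport fun h => hx (hgs h), zero_smul]

/-! ### Injectivity of the Green operator -/

/-- The `star` cancels the conjugation in the inner product and leaves the bilinear pairing in which
`-w⁻¹ (p f')'` is symmetric. -/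
theorem inner_toLp_star {ε : ℝ} {a : ℝ → ℂ} (ha : MemLp a 2 (wMeasure ε))
    {v : L2w ε} {b : ℝ → ℂ} (hb : v =ᵐ[wMeasure ε] b) :
    inner ℂ (ha.star.toLp _) v = ∫ y in Ioo (0 : ℝ) 1, a y * b y * (w ε y : ℂ) := by
  rw [L2.inner_def, integral_wMeasure]
  refine integral_congr_ae ?_
  filter_upwards [(ae_wMeasure_iff ε).1 ha.star.coeFn_toLp, (ae_wMeasure_iff ε).1 hb] with y h1 h2
  rw [h1, h2, RCLike.inner_apply, Pi.star_apply, Complex.star_def, Complex.conj_conj,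
    Complex.real_smul]
  ring

theorem dense_range_slMap {ε : ℝ} (hε : 0 < ε) : Dense (range (slMap ε hε)) := by
  rw [← LinearMap.coe_range, Submodule.dense_iff_topologicalClosure_eq_top,
    Submodule.topologicalClosure_eq_top_iff, Submodule.eq_bot_iff]
  refine fun u hu => eq_zero_of_forall_integral_testFunction hε u fun g hg hgs => ?_
  obtain ⟨f, hf⟩ := exists_slExpr_eq ε hg hgs
  have h0 : inner ℂ (slMap ε hε f) u = 0 := (Submodule.mem_orthogonal _ _).1 hu _ ⟨f, rfl⟩
  rw [L2.inner_def, integral_wMeasure] at h0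
  rw [← h0]
  refine integral_congr_ae ?_
  have h2 : slMap ε hε f =ᵐ[wMeasure ε] slExpr ε f := (memLp_slExpr ε hε f).coeFn_toLp
  filter_upwards [(ae_wMeasure_iff ε).1 h2, ae_restrict_mem measurableSet_Ioo] with x hx hx'
  rw [hx, hf x hx', RCLike.inner_apply, Complex.conj_ofReal, Complex.real_smul]
  ring

/-- Both sides are continuous in `v`, so it suffices to take `v` in the dense range of `slMap`,
where `greenOp_slMap` reduces the claim to formal symmetry. -/
theorem inner_star_greenOp {ε : ℝ} (hε : 0 < ε) (hε2 : ε < 2) (g : smoothZero) (v : L2w ε) :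
    inner ℂ ((memLp_slExpr ε hε g).star.toLp _) (greenOp hε hε2 v) =
      inner ℂ ((memLp_smoothZero ε hε g).star.toLp _) v := by
  have h : (fun v => inner ℂ ((memLp_slExpr ε hε g).star.toLp _) (greenOp hε hε2 v)) =
      fun v => inner ℂ ((memLp_smoothZero ε hε g).star.toLp _) v := by
    refine Continuous.ext_on (dense_range_slMap hε) (by fun_prop) (by fun_prop) ?_
    rintro _ ⟨f, rfl⟩
    have h1 : incl ε hε f =ᵐ[wMeasure ε] (f : ℝ → ℂ) := (memLp_smoothZero ε hε f).coeFn_toLp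
    have h2 : slMap ε hε f =ᵐ[wMeasure ε] slExpr ε f := (memLp_slExpr ε hε f).coeFn_toLp
    simp only [greenOp_slMap]
    rw [inner_toLp_star (memLp_slExpr ε hε g) h1, inner_toLp_star (memLp_smoothZero ε hε g) h2, integral_slExpr_mul hε f g]
  exact congrFun h v

theorem injective_greenOp {ε : ℝ} (hε : 0 < ε) (hε2 : ε < 2) :
    Function.Injective (greenOp hε hε2) := by
  rw [injective_iff_map_eq_zero]
  refine fun v hv => eq_zero_of_forall_integral_testFunction hε v fun g hg hgs => ?_
  have hg0 : g 0 = 0 := image_eq_zero_of_notMem_tsupport fun h => lt_irrefl _ (hgs h).1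
  have h := inner_star_greenOp hε hε2
    ⟨fun x => (g x : ℂ), (Complex.ofRealCLM.contDiff.comp hg).contDiffOn, by simp [hg0]⟩ v
  rw [hv, inner_zero_right, inner_toLp_star (memLp_smoothZero ε hε _) (ae_eq_refl _)] at h
  exact h.symm

/-! ### The closure and its inverse -/

/-- If a bounded operator `R` is a left inverse of an operator `T` with dense range, then `T` is
closable and `R` is the inverse of its closure. -/
theorem _root_.LinearPMap.isClosable_and_closure_inverse {𝕜 E F : Type*}
    [NontriviallyNormedField 𝕜]
    [NormedAddCommGroup E] [NormedSpace 𝕜 E] [NormedAddCommGroup F] [NormedSpace 𝕜 F]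
    (T : E →ₗ.[𝕜] F) (R : F →L[𝕜] E) (hR : ∀ x : T.domain, R (T x) = x)
    (hd : Dense (range T)) (hinj : Function.Injective R) :
    T.IsClosable ∧ (∀ v, ∃ h : R v ∈ T.closure.domain, T.closure ⟨R v, h⟩ = v) ∧
      ∀ u : T.closure.domain, R (T.closure u) = u := by
  -- The closure of the graph is `{(R v, v)}`: this set is closed and contains the graph, and
  -- conversely `v ↦ (R v, v)` is continuous and maps the dense range of `T` into the graph.
  have hg : ∀ z : E × F, z ∈ T.graph.topologicalClosure ↔ R z.2 = z.1 := by
    intro z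
    constructor
    · have hc : IsClosed {z : E × F | R z.2 = z.1} :=
        isClosed_eq (R.continuous.comp continuous_snd) continuous_fst
      refine fun hz => closure_minimal (fun y hy => ?_) hc hz
      obtain ⟨x, h1, h2⟩ := (LinearPMap.mem_graph_iff T).1 hy
      rw [mem_ofPred_eq, ← h2, ← h1, hR]
    · obtain ⟨u, v⟩ := z
      intro hz
      obtain rfl : R v = u := hz
      have hm : MapsTo (fun v => (R v, v)) (range T) T.graph := by
        rintro _ ⟨x, rfl⟩
        simp only [SetLike.mem_coe, hR]
        exact T.mem_graph x
      exact map_mem_closure (f := fun v => (R v, v)) (R.continuous.prodMk continuous_id) (hd v) hm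
  have hcl : T.IsClosable := by
    refine ⟨T.graph.topologicalClosure.toLinearPMap,
      (Submodule.toLinearPMap_graph_eq _ fun z hz hz1 => ?_).symm⟩
    -- A point `(0, v)` of the closed graph has `R v = 0`, so `v = 0`.
    exact hinj (by rw [(hg z).1 hz, hz1, map_zero])
  rw [hcl.graph_closure_eq_closure_graph] at hg
  refine ⟨hcl, fun v => ?_, fun u => (hg _).1 (T.closure.mem_graph u)⟩
  obtain ⟨⟨x, hx⟩, h1, h2⟩ := (LinearPMap.mem_graph_iff _).1 ((hg (R v, v)).2 rfl)
  obtain rfl : x = R v := h1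
  exact ⟨hx, h2⟩

theorem greenOp_L {ε : ℝ} (hε : 0 < ε) (hε2 : ε < 2) (x : (L ε hε).domain) :
    greenOp hε hε2 (L ε hε x) = x := by
  have h := (L ε hε).mem_graph x
  rw [L_graph] at h
  obtain ⟨f, hf⟩ := h
  obtain ⟨h1, h2⟩ := Prod.mk.inj hf
  rw [← h1, ← h2, greenOp_slMap]

theorem dense_range_L {ε : ℝ} (hε : 0 < ε) : Dense (range (L ε hε)) := by
  refine (dense_range_slMap hε).mono ?_
  rintro _ ⟨f, rfl⟩
  have h : (incl ε hε f, slMap ε hε f) ∈ (L ε hε).graph := by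
    rw [L_graph]
    exact ⟨f, rfl⟩
  obtain ⟨x, -, hx⟩ := (LinearPMap.mem_graph_iff _).1 h
  exact ⟨x, hx⟩

end SturmLiouville

open SturmLiouville MeasureTheory in
theorem mainTheorem4 (ε : ℝ) (hε : 0 < ε) (hε2 : ε < 2) :
    (SturmLiouville.L ε hε).IsClosable ∧
    MeasureTheory.MemLp (fun z : ℝ × ℝ => SturmLiouville.G ε z.1 z.2) 2
      ((SturmLiouville.wMeasure ε).prod (SturmLiouville.wMeasure ε)) ∧
    ∃ R : SturmLiouville.L2w ε →L[ℂ] SturmLiouville.L2w ε,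
      IsCompactOperator R ∧
      (∀ f : SturmLiouville.L2w ε,
        (∀ x ∈ Set.Ico (0 : ℝ) 1,
          MeasureTheory.IntegrableOn
            (fun y => (SturmLiouville.G ε x y : ℂ) * f y * (SturmLiouville.w ε y : ℂ))
            (Set.Ioo 0 1)) ∧
        ∀ᵐ x ∂(SturmLiouville.wMeasure ε),
          (R f : ℝ → ℂ) x =
            ∫ y in Set.Ioo (0 : ℝ) 1,
              (SturmLiouville.G ε x y : ℂ) * f y * (SturmLiouville.w ε y : ℂ)) ∧
      (∀ f : SturmLiouville.L2w ε, ∃ h : R f ∈ (SturmLiouville.L ε hε).closure.domain,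
        (SturmLiouville.L ε hε).closure ⟨R f, h⟩ = f) ∧
      (∀ u : (SturmLiouville.L ε hε).closure.domain,
        R ((SturmLiouville.L ε hε).closure u) = u) := by
  obtain ⟨hcl, hinv⟩ := LinearPMap.isClosable_and_closure_inverse (L ε hε)
    (greenOp hε hε2) (greenOp_L hε hε2) (dense_range_L hε) (injective_greenOp hε hε2)
  exact ⟨hcl, memLp_G hε hε2, greenOp hε hε2, isCompactOperator_greenOp hε hε2,
    fun f => ⟨fun x hx => integrableOn_mul_mul_w ε (memLp_G_slice hε hε2 hx) (Lp.memLp f),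
      greenOp_apply hε hε2 f⟩, hinv⟩
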